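/- Let $K/k$ be a Galois field extension of finite degree $\ell$ with cyclic Galois group generated by $\theta$, and let $B=(B_1,\dots,B_\ell)$ be a $k$-basis of $K$. For $x\in K$ let $\epsilon_B(x)\in k^{\ell\times 1}$ be the coordinate column of $x$ with respect to $B$, and for $c=(c_1,\dots,c_m)\in K^m$ let $\epsilon_B(c)\in k^{\ell\times m}$ be the matrix with columns $\epsilon_B(c_1),\dots,\epsilon_B(c_m)$. Let $m\ge 1$ and let $v=(v_1,\dots,v_m)\in K^m$ be a Gabidulin vector, i.e. the $k$-space $V_v:=\langle v_1,\dots,v_m\rangle_k\le K$ has dimension $m$, and suppose $v_1=1$. For $1\le d<m$ put $$\mathcal C(v,\theta,d):=\epsilon_B\bigl(\langle v,\theta(v),\dots,\theta^{d-1}(v)\rangle_K\bigr)\le k^{\ell\times m},$$ where $\theta$ acts on $K^m$ entrywise, and for a subspace $\mathcal C\le k^{\ell\times m}$ put $$\operatorname{Aut}(\mathcal C):=\{(g,h)\in \mathrm{GL}_\ell(k)\times\mathrm{GL}_m(k)\mid g^{-1}\mathcal C h=\mathcal C\}.$$ Let $M$, $k\le M\le K$, be the largest subfield such that $V_v$ is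 an $M$-linear subspace of $K$, let $F:=k[v_2,\dots,v_m]$, and let $s:=[K:F]$. Then $F$ is the smallest intermediate field of $K/k$ that contains $V_v$, the automorphism $\theta$ restricts to $F$ and $\operatorname{Gal}(F/k)=\langle\theta_{|F}\rangle$, and there is a subgroup $G\le\operatorname{Gal}(F/k)$ such that for every $1\le d<m$ $$\operatorname{Aut}(\mathcal C(v,\theta,d))\cong(\mathrm{GL}_s(F)\times M^\times).G,$$ that is, there is a short exact sequence of groups $$1\to \mathrm{GL}_s(F)\times M^\times\to\operatorname{Aut}(\mathcal C(v,\theta,d))\to G\to 1.$$ -/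

import Mathlib

namespace GabidulinLike

section Codes

variable {k K : Type*} [Field k] [Field K] [Algebra k K] {ℓ m : ℕ}

/-- The `k`-subspace `V_v = ⟨v_1, …, v_m⟩_k` of `K` spanned by the entries of `v`. -/
def entrySpan (k : Type*) {K : Type*} [Field k] [Field K] [Algebra k K] {m : ℕ}
    (v : Fin m → K) : Submodule k K :=
  Submodule.span k (Set.range v)

/-- The rank of `v ∈ K^m` is the `k`-dimension of `V_v`; `v` is a Gabidulin vector if its
rank equals `m`. -/
def IsGabidulinVector (k : Type*) {K : Type*} [Field k] [Field K] [Algebra k K] {m : ℕ}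
    (v : Fin m → K) : Prop :=
  Module.finrank k (entrySpan k v) = m

/-- The `K`-linear code `⟨v, θ(v), …, θ^{d-1}(v)⟩_K ≤ K^m`, with `θ` applied entrywise. -/
def vectorCode (v : Fin m → K) (θ : K ≃ₐ[k] K) (d : ℕ) : Submodule K (Fin m → K) :=
  Submodule.span K {w | ∃ j < d, w = fun i => (θ ^ j) (v i)}

/-- `ε_B` applied entrywise: the `j`-th column of `ε_B(c)` is the coordinate column of `c_j`
with respect to the `k`-basis `B` of `K`. -/
noncomputable def epsilon (B : Module.Basis (Fin ℓ) k K) : (Fin m → K) →ₗ[k] Matrix (Fin ℓ) (Fin m) k where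
  toFun c := Matrix.of fun i j => B.repr (c j) i
  map_add' c c' := by ext i j; simp
  map_smul' a c := by ext i j; simp

/-- The lifted code `ε_B(C) ≤ k^{ℓ × m}` of a `K`-linear code `C ≤ K^m`. -/
noncomputable def liftedCode (B : Module.Basis (Fin ℓ) k K) (C : Submodule K (Fin m → K)) :
    Submodule k (Matrix (Fin ℓ) (Fin m) k) :=
  (C.restrictScalars k).map (epsilon B)

/-- The code `C(v, θ, d) ≤ k^{ℓ × m}`. -/
noncomputable def code (B : Module.Basis (Fin ℓ) k K) (v : Fin m → K) (θ : K ≃ₐ[k] K) (d : ℕ) :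
    Submodule k (Matrix (Fin ℓ) (Fin m) k) :=
  liftedCode B (vectorCode v θ d)

/-- The map `X ↦ g⁻¹ X h` on `k^{ℓ × m}`. -/
def kappa (p : GL (Fin ℓ) k × GL (Fin m) k) (X : Matrix (Fin ℓ) (Fin m) k) :
    Matrix (Fin ℓ) (Fin m) k :=
  ((p.1⁻¹ : GL (Fin ℓ) k) : Matrix (Fin ℓ) (Fin ℓ) k) * X * (p.2 : Matrix (Fin m) (Fin m) k)

theorem kappa_one (X : Matrix (Fin ℓ) (Fin m) k) : kappa 1 X = X := by
  simp [kappa]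

theorem kappa_mul (p q : GL (Fin ℓ) k × GL (Fin m) k) (X : Matrix (Fin ℓ) (Fin m) k) :
    kappa (p * q) X = kappa q (kappa p X) := by
  simp only [kappa, Prod.fst_mul, Prod.snd_mul, mul_inv_rev, Units.val_mul, Matrix.mul_assoc]

/-- The (proper) automorphism group
`Aut(C) = {(g, h) ∈ GL_ℓ(k) × GL_m(k) | g⁻¹ C h = C}` of a code `C ≤ k^{ℓ × m}`. -/
def codeAut (C : Submodule k (Matrix (Fin ℓ) (Fin m) k)) :
    Subgroup (GL (Fin ℓ) k × GL (Fin m) k) where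
  carrier := {p | kappa p '' (C : Set (Matrix (Fin ℓ) (Fin m) k)) = C}
  one_mem' := by
    have h : kappa (1 : GL (Fin ℓ) k × GL (Fin m) k) = id := funext kappa_one
    simp [h]
  mul_mem' := by
    intro p q hp hq
    have h : kappa (p * q) = kappa q ∘ kappa p := funext (kappa_mul p q)
    simp only [Set.mem_ofPred_eq] at hp hq ⊢
    rw [h, Set.image_comp, hp, hq]
  inv_mem' := by
    intro p hp
    simp only [Set.mem_ofPred_eq] at hp ⊢
    have h : kappa p⁻¹ ∘ kappa p = id := by
      funext X
      rw [Function.comp_apply, ← kappa_mul, mul_inv_cancel, kappa_one, id]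
    conv_lhs => rw [← hp]
    rw [← Set.image_comp, h, Set.image_id]

end Codes

end GabidulinLike

/-!
Reading a vector `c ∈ K^m` as the `k`-linear map `V_v → K` with `v_i ↦ c_i`, the code becomes the
`K`-span `C` of the restrictions to `V_v` of `θ^j`, `j < d`, and `X ↦ g⁻¹ X h` becomes the inverse
of `f ↦ g ∘ f ∘ h⁻¹`. The restriction of `θ^d` is not in `C`: otherwise composition with `θ` would
preserve `C`, which would then contain the restrictions of all powers of `θ`; by Artin these span
`Hom_k(V_v, K)`, so that `m ≤ d`. Hence if `θ^i ∘ f ∈ C` for all `i < d`, then `f` is a multiple of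
the inclusion of `V_v`.

Let `(g, h)` preserve `C` and write `g = ∑ a_σ σ`. As `C` is a `K`-space and the automorphisms are
linearly independent, the single terms `a_σ σ θ^j h⁻¹` lie in `C` too, and since `σ` commutes with
`θ`, the restriction of `σ` to `V_v` is a multiple of `h` whenever `a_σ ≠ 0`. Evaluating at
`1 ∈ V_v`, all these `σ` agree on `V_v`, hence on the field `F` it generates. So `g` is semilinear
over `F` with respect to `σ_{|F}`, and `h` is `σ_{|F}` followed by multiplication by `h(1) ∈ F`.
Conversely all such pairs preserve `C`. This description does not involve `d`, and the pairs with
`σ_{|F} = 1` are the `F`-linear `g` together with the multiplications of `V_v` by units of `M`.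
-/

namespace GabidulinLike

section Artin

theorem mem_of_forall_sum_smul_mem {ι X L W : Type*} [Fintype ι] [Field L] [AddCommGroup W]
    [Module L W] {φ : ι → X → L} (hφ : LinearIndependent L φ) {C : Submodule L W} {u : ι → W}
    (h : ∀ x, ∑ i, φ i x • u i ∈ C) (i : ι) : u i ∈ C := by
  by_contra hi
  obtain ⟨f, hfi, hfC⟩ := Submodule.exists_le_ker_of_notMem hi
  refine hfi (Fintype.linearIndependent_iff.1 hφ (fun i => f (u i)) (funext fun x => ?_) i)
  simpa [mul_comm] using hfC (h x)

theorem sum_mul_map_mul {ι Φ R S : Type*} [Fintype ι] [Mul R] [CommSemiring S] [FunLike Φ R S]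
    [MulHomClass Φ R S] {a : ι → S} {φ : ι → Φ} {x : R} {c : S} (hx : ∀ i, a i ≠ 0 → φ i x = c)
    (y : R) : ∑ i, a i * φ i (x * y) = c * ∑ i, a i * φ i y := by
  rw [Finset.mul_sum]
  refine Finset.sum_congr rfl fun i _ => ?_
  by_cases hi : a i = 0
  · simp only [hi, zero_mul, mul_zero]
  · rw [map_mul, hx i hi, mul_left_comm]

variable (k K : Type*) [Field k] [Field K] [Algebra k K]

theorem linearIndependent_algEquiv : LinearIndependent K (fun (σ : K ≃ₐ[k] K) (x : K) => σ x) :=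
  (linearIndependent_monoidHom K K).comp (fun σ : K ≃ₐ[k] K => (σ : K →* K))
    fun _ _ h => AlgEquiv.ext (DFunLike.congr_fun h :)

variable [FiniteDimensional k K] [IsGalois k K]

theorem span_range_algEquiv_toLinearMap :
    Submodule.span K (Set.range (AlgEquiv.toLinearMap : (K ≃ₐ[k] K) → K →ₗ[k] K)) = ⊤ := by
  have hli : LinearIndependent K (AlgEquiv.toLinearMap : (K ≃ₐ[k] K) → K →ₗ[k] K) :=
    .of_comp (LinearMap.ltoFun k K K K) (linearIndependent_algEquiv k K)
  refine hli.span_eq_top_of_card_eq_finrank' ?_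
  rw [Module.finrank_linearMap_self, ← Nat.card_eq_fintype_card, IsGalois.card_aut_eq_finrank]

variable {k K}

theorem exists_eq_sum_smul_algEquiv (g : K →ₗ[k] K) :
    ∃ a : (K ≃ₐ[k] K) → K, g = ∑ σ, a σ • σ.toLinearMap := by
  have hg : g ∈ Submodule.span K (Set.range (AlgEquiv.toLinearMap (R := k) (A₁ := K))) :=
    span_range_algEquiv_toLinearMap k K ▸ Submodule.mem_top
  obtain ⟨a, ha⟩ := (Submodule.mem_span_range_iff_exists_fun K).1 hg
  exact ⟨a, ha.symm⟩

theorem span_range_algEquiv_domRestrict (V : Submodule k K) :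
    Submodule.span K (Set.range fun σ : K ≃ₐ[k] K => σ.toLinearMap.domRestrict V) = ⊤ := by
  have hsurj : Function.Surjective (LinearMap.lcomp K K V.subtype) := fun f =>
    LinearMap.exists_extend f
  have h := Submodule.map_span (LinearMap.lcomp K K V.subtype)
    (Set.range (AlgEquiv.toLinearMap : (K ≃ₐ[k] K) → K →ₗ[k] K))
  rw [span_range_algEquiv_toLinearMap, Submodule.map_top, LinearMap.range_eq_top.2 hsurj,
    ← Set.range_comp] at h
  exact h.symm

end Artin

section ConjSpan

variable {k K : Type*} [Field k] [Field K] [Algebra k K]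

/-- The coordinate-free form of `C(v, θ, d)`: a vector `c ∈ K^m` is read as the `k`-linear map
`V_v → K` that sends `v_i` to `c_i`, so that `θ^j(v)` becomes the restriction of `θ^j`. -/
def conjSpan (θ : K ≃ₐ[k] K) (V : Submodule k K) (d : ℕ) : Submodule K (V →ₗ[k] K) :=
  Submodule.span K ((fun j : ℕ => (θ ^ j).toLinearMap.domRestrict V) '' Set.Iio d)

variable {θ : K ≃ₐ[k] K} {V : Submodule k K} {d : ℕ}

theorem domRestrict_pow_mem_conjSpan {j : ℕ} (hj : j < d) :
    (θ ^ j).toLinearMap.domRestrict V ∈ conjSpan θ V d :=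
  Submodule.subset_span ⟨j, hj, rfl⟩

theorem mem_conjSpan_succ {f : V →ₗ[k] K} :
    f ∈ conjSpan θ V (d + 1) ↔
      ∃ a : K, ∃ g ∈ conjSpan θ V d, f = a • (θ ^ d).toLinearMap.domRestrict V + g := by
  rw [conjSpan, ← Order.succ_eq_add_one, Order.Iio_succ_eq_insert, Set.image_insert_eq,
    Submodule.mem_span_insert]
  rfl

theorem mem_conjSpan_one {f : V →ₗ[k] K} :
    f ∈ conjSpan θ V 1 ↔ ∃ a : K, ∀ x, f x = a * x := by
  rw [← zero_add 1, mem_conjSpan_succ]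
  have h0 : conjSpan θ V 0 = ⊥ := by simp [conjSpan]
  simp only [h0, Submodule.mem_bot, exists_eq_left, add_zero, pow_zero]
  simp only [LinearMap.ext_iff]
  rfl

theorem comp_mem_conjSpan (i : ℕ) {f : V →ₗ[k] K} (hf : f ∈ conjSpan θ V d) :
    (θ ^ i).toLinearMap ∘ₗ f ∈ conjSpan θ V (i + d) := by
  induction hf using Submodule.span_induction with
  | mem f hf =>
    obtain ⟨j, hj, rfl⟩ := hf
    convert domRestrict_pow_mem_conjSpan (Nat.add_lt_add_left hj i) using 1
    rw [pow_add]
    rfl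
  | zero => simp
  | add f g _ _ hf hg => simpa [LinearMap.comp_add] using add_mem hf hg
  | smul a f _ hf =>
    convert Submodule.smul_mem _ ((θ ^ i) a) hf using 1
    ext x
    simp

theorem finrank_conjSpan_le : Module.finrank K (conjSpan θ V d) ≤ d := by
  classical
  rw [conjSpan, ← Finset.coe_range, ← Finset.coe_image]
  exact (finrank_span_finset_le_card _).trans (Finset.card_image_le.trans (by simp))

variable [FiniteDimensional k K] [IsGalois k K]

theorem domRestrict_pow_notMem_conjSpan (hθ : ∀ σ : K ≃ₐ[k] K, σ ∈ Subgroup.zpowers θ)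
    (hd : d < Module.finrank k V) : (θ ^ d).toLinearMap.domRestrict V ∉ conjSpan θ V d := by
  intro hmem
  have hsucc : conjSpan θ V (d + 1) ≤ conjSpan θ V d := by
    intro f hf
    obtain ⟨a, g, hg, rfl⟩ := mem_conjSpan_succ.1 hf
    exact add_mem (Submodule.smul_mem _ a hmem) hg
  have hpow (j : ℕ) : (θ ^ j).toLinearMap.domRestrict V ∈ conjSpan θ V d := by
    induction j with
    | zero =>
      rcases d.eq_zero_or_pos with rfl | hd0
      exacts [hmem, domRestrict_pow_mem_conjSpan hd0]
    | succ j ih =>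
      rw [pow_succ']
      exact hsucc (add_comm 1 d ▸ comp_mem_conjSpan 1 ih)
  have htop : conjSpan θ V d = ⊤ := by
    rw [eq_top_iff, ← span_range_algEquiv_domRestrict V, Submodule.span_le]
    rintro _ ⟨σ, rfl⟩
    obtain ⟨j, rfl⟩ := mem_powers_iff_mem_zpowers.2 (hθ σ)
    exact hpow j
  have hle : Module.finrank k V ≤ d := by
    rw [← Module.finrank_linearMap_self k K V, ← finrank_top, ← htop]
    exact finrank_conjSpan_le
  exact hd.not_ge hle

theorem mem_conjSpan_one_of_forall_comp_mem (hθ : ∀ σ : K ≃ₐ[k] K, σ ∈ Subgroup.zpowers θ)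
    (hd : 1 ≤ d) (hdV : d < Module.finrank k V) {f : V →ₗ[k] K}
    (hf : ∀ i < d, (θ ^ i).toLinearMap ∘ₗ f ∈ conjSpan θ V d) : f ∈ conjSpan θ V 1 := by
  refine Nat.decreasingInduction' (P := fun e => f ∈ conjSpan θ V e) (fun e hed he hfe => ?_) hd
    (hf 0 hd)
  obtain ⟨a, g, hg, rfl⟩ := mem_conjSpan_succ.1 hfe
  suffices a = 0 by simpa [this] using hg
  by_contra ha
  have hlow : (θ ^ (d - e)).toLinearMap ∘ₗ g ∈ conjSpan θ V d := by
    simpa [Nat.sub_add_cancel hed.le] using comp_mem_conjSpan (d - e) hg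
  have htop : (θ ^ (d - e)) a • (θ ^ d).toLinearMap.domRestrict V ∈ conjSpan θ V d := by
    convert sub_mem (hf (d - e) (by omega)) hlow using 1
    ext x
    have hx : (θ ^ (d - e)) ((θ ^ e) x) = (θ ^ d) x := by
      rw [← AlgEquiv.mul_apply, ← pow_add, Nat.sub_add_cancel hed.le]
    simp only [LinearMap.smul_apply, LinearMap.domRestrict_apply, AlgEquiv.toLinearMap_apply,
      smul_eq_mul, LinearMap.sub_apply, LinearMap.comp_apply, LinearMap.add_apply, map_add,
      map_mul, hx, add_sub_cancel_right]
  exact domRestrict_pow_notMem_conjSpan hθ hdV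
    ((Submodule.smul_mem_iff _ ((map_ne_zero _).2 ha)).1 htop)

end ConjSpan

section Semilinear

variable {k K : Type*} [Field k] [Field K] [Algebra k K]
variable {V : Submodule k K} {F : IntermediateField k K}

/-- The triples `(g, h, σ)` such that `g` is `σ`-semilinear over `F` and `h` is the restriction
of `σ` to `V ≤ F` followed by multiplication by a nonzero `b ∈ F`. Carrying `σ` along makes the
projection to `Gal(F/k)` a group homomorphism. -/
def semilinearTriples (hVF : ∀ x ∈ V, x ∈ F) :
    Subgroup ((K ≃ₗ[k] K) × (V ≃ₗ[k] V) × (F ≃ₐ[k] F)) where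
  carrier := {t | (∀ (x : F) (y : K), t.1 (x * y) = t.2.2 x * t.1 y) ∧
    ∃ b : F, b ≠ 0 ∧ ∀ x : V, (t.2.1 x : K) = b * t.2.2 ⟨x, hVF x x.2⟩}
  one_mem' := ⟨fun _ _ => rfl, 1, one_ne_zero, fun x => (one_mul (x : K)).symm⟩
  mul_mem' := by
    rintro ⟨g, h, σ⟩ ⟨g', h', σ'⟩ ⟨hg, b, hb, hh⟩ ⟨hg', b', hb', hh'⟩
    refine ⟨fun x y => ?_, b * σ b', mul_ne_zero hb ((map_ne_zero σ).2 hb'), fun x => ?_⟩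
    · exact (congrArg g (hg' x y)).trans (hg (σ' x) (g' y))
    · have hx : (⟨h' x, hVF _ (h' x).2⟩ : F) = b' * σ' ⟨x, hVF x x.2⟩ := Subtype.ext (hh' x)
      calc (h (h' x) : K) = b * σ ⟨h' x, hVF _ (h' x).2⟩ := hh (h' x)
        _ = (b * σ b' : F) * σ (σ' ⟨x, hVF x x.2⟩) := by
          rw [hx, map_mul]
          exact (mul_assoc (b : K) _ _).symm
  inv_mem' := by
    rintro ⟨g, h, σ⟩ ⟨hg, b, hb, hh⟩
    refine ⟨fun x y => g.injective ?_, (σ⁻¹ b)⁻¹, inv_ne_zero ((map_ne_zero _).2 hb), fun x => ?_⟩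
    · calc g (g⁻¹ (x * y)) = σ (σ⁻¹ x) * g (g⁻¹ y) := by
            rw [← LinearEquiv.mul_apply, ← LinearEquiv.mul_apply, ← AlgEquiv.mul_apply]
            simp
        _ = g (σ⁻¹ x * g⁻¹ y) := (hg _ _).symm
    · have hx : (⟨x, hVF x x.2⟩ : F) = b * σ ⟨h⁻¹ x, hVF _ (h⁻¹ x).2⟩ :=
        Subtype.ext (by simpa [← LinearEquiv.mul_apply] using hh (h⁻¹ x))
      have hy : σ⁻¹ ⟨x, hVF x x.2⟩ = σ⁻¹ b * ⟨h⁻¹ x, hVF _ (h⁻¹ x).2⟩ := by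
        rw [hx, map_mul, ← AlgEquiv.mul_apply, inv_mul_cancel, AlgEquiv.one_apply]
      have hb' : σ⁻¹ b ≠ 0 := (map_ne_zero _).2 hb
      exact congrArg Subtype.val (eq_inv_mul_iff_mul_eq₀ hb' |>.2 hy.symm)

variable {hVF : ∀ x ∈ V, x ∈ F} {θ : K ≃ₐ[k] K} {d : ℕ}

theorem comp_mem_conjSpan_of_mem_semilinearTriples [IsAbelianGalois k K] {g : K ≃ₗ[k] K}
    {h : V ≃ₗ[k] V} {σ : F ≃ₐ[k] F} (ht : (g, h, σ) ∈ semilinearTriples hVF) {f : V →ₗ[k] K}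
    (hf : f ∈ conjSpan θ V d) : g.toLinearMap ∘ₗ f ∘ₗ h.symm.toLinearMap ∈ conjSpan θ V d := by
  obtain ⟨hg, b, hb, hh⟩ := ht
  induction hf using Submodule.closure_induction with
  | zero => simp
  | add f₁ f₂ _ _ h₁ h₂ => simpa [LinearMap.add_comp, LinearMap.comp_add] using add_mem h₁ h₂
  | smul_mem a f hf =>
    obtain ⟨j, hj, rfl⟩ := hf
    convert Submodule.smul_mem _ (g a * ((θ ^ j) b)⁻¹) (domRestrict_pow_mem_conjSpan hj) using 1
    ext x
    set y : F := ⟨h.symm x, hVF _ (h.symm x).2⟩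
    set τ := (θ ^ j).restrictNormal F
    have hτ (z : F) : (τ z : K) = (θ ^ j) z := (θ ^ j).restrictNormal_commutes F z
    have hx : (θ ^ j) x = (θ ^ j) b * σ (τ y) := by
      have hcomm : τ (σ y) = σ (τ y) := DFunLike.congr_fun (IsMulCommutative.is_comm.comm τ σ) y
      rw [← hcomm, hτ, ← map_mul, ← hh, h.apply_symm_apply]
    have hb' : (θ ^ j) b ≠ 0 := (map_ne_zero _).2 (Subtype.coe_ne_coe.2 hb)
    calc g (a * (θ ^ j) y) = σ (τ y) * g a := by rw [← hτ, mul_comm, hg]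
      _ = g a * ((θ ^ j) b)⁻¹ * (θ ^ j) x := by rw [hx]; field_simp

theorem exists_forall_eq_mul_of_comp_mem_conjSpan [FiniteDimensional k K] [IsGalois k K]
    (hθ : ∀ σ : K ≃ₐ[k] K, σ ∈ Subgroup.zpowers θ) (hd : 1 ≤ d) (hdV : d < Module.finrank k V)
    {a : (K ≃ₐ[k] K) → K} {h : V ≃ₗ[k] V}
    (hmem : ∀ f ∈ conjSpan θ V d,
      (∑ σ, a σ • σ.toLinearMap) ∘ₗ f ∘ₗ h.symm.toLinearMap ∈ conjSpan θ V d)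
    {σ : K ≃ₐ[k] K} (hσ : a σ ≠ 0) : ∃ c : K, ∀ x : V, σ x = c * h x := by
  suffices σ.toLinearMap.domRestrict V ∘ₗ h.symm.toLinearMap ∈ conjSpan θ V 1 by
    obtain ⟨c, hc⟩ := mem_conjSpan_one.1 this
    exact ⟨c, fun x => by simpa using hc (h x)⟩
  refine mem_conjSpan_one_of_forall_comp_mem hθ hd hdV fun j hj => ?_
  have hsep := mem_of_forall_sum_smul_mem (linearIndependent_algEquiv k K)
    (C := conjSpan θ V d)
    (u := fun τ => a τ • (τ * θ ^ j).toLinearMap.domRestrict V ∘ₗ h.symm.toLinearMap)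
    (fun y => ?_) σ
  · have hcomm : σ * θ ^ j = θ ^ j * σ := by
      obtain ⟨n, rfl⟩ := hθ σ
      exact ((Commute.refl θ).zpow_left n).pow_right j
    rw [hcomm] at hsep
    exact (Submodule.smul_mem_iff _ hσ).1 hsep
  · convert hmem _ (Submodule.smul_mem _ y (domRestrict_pow_mem_conjSpan hj)) using 1
    ext x
    simp [mul_left_comm]

theorem algHom_eqOn_of_isLeast [Algebra.IsAlgebraic k K] {A : Type*} [Semiring A] [Algebra k A]
    (hF : IsLeast {E : IntermediateField k K | ∀ x ∈ V, x ∈ E} F) {σ τ : K →ₐ[k] A}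
    (hστ : ∀ x ∈ V, σ x = τ x) (x : F) : σ x = τ x := by
  have hFE : F ≤ subalgebraEquivIntermediateField (AlgHom.equalizer σ τ) :=
    hF.2 fun y hy => mem_subalgebraEquivIntermediateField.2 (hστ y hy)
  exact mem_subalgebraEquivIntermediateField.1 (hFE x.2)

theorem exists_mem_semilinearTriples [FiniteDimensional k K] [IsAbelianGalois k K]
    (hθ : ∀ σ : K ≃ₐ[k] K, σ ∈ Subgroup.zpowers θ) (hd : 1 ≤ d) (hdV : d < Module.finrank k V)
    (h1 : (1 : K) ∈ V) (hF : IsLeast {E : IntermediateField k K | ∀ x ∈ V, x ∈ E} F)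
    {g : K ≃ₗ[k] K} {h : V ≃ₗ[k] V}
    (hmem : ∀ f ∈ conjSpan θ V d, g.toLinearMap ∘ₗ f ∘ₗ h.symm.toLinearMap ∈ conjSpan θ V d) :
    ∃ σ, (g, h, σ) ∈ semilinearTriples hF.1 := by
  obtain ⟨a, ha⟩ := exists_eq_sum_smul_algEquiv g.toLinearMap
  rw [ha] at hmem
  set b : K := ((h ⟨1, h1⟩ : V) : K)
  have hbσ {σ : K ≃ₐ[k] K} (hσ : a σ ≠ 0) : b ≠ 0 ∧ ∀ x : V, (h x : K) = b * σ x := by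
    obtain ⟨c, hc⟩ := exists_forall_eq_mul_of_comp_mem_conjSpan hθ hd hdV hmem hσ
    have hcb : 1 = c * b := by simpa using hc ⟨1, h1⟩
    refine ⟨right_ne_zero_of_mul_eq_one hcb.symm, fun x => ?_⟩
    rw [hc, ← mul_assoc, mul_comm b, ← hcb, one_mul]
  obtain ⟨σ, hσ⟩ : ∃ σ, a σ ≠ 0 := by
    by_contra! h0
    have : g 1 = 0 := by simpa [h0] using LinearMap.congr_fun ha 1
    simp at this
  obtain ⟨hb0, hhσ⟩ := hbσ hσ
  have hagree (τ : K ≃ₐ[k] K) (hτ : a τ ≠ 0) (x : F) : τ x = σ x :=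
    algHom_eqOn_of_isLeast hF (σ := τ.toAlgHom) (τ := σ.toAlgHom)
      (fun y hy => mul_left_cancel₀ hb0 (((hbσ hτ).2 ⟨y, hy⟩).symm.trans (hhσ ⟨y, hy⟩))) x
  have hσF (x : F) : (σ.restrictNormal F x : K) = σ x := σ.restrictNormal_commutes F x
  have hga (y : K) : g y = ∑ τ, a τ * τ y := by simpa using LinearMap.congr_fun ha y
  refine ⟨σ.restrictNormal F, fun x y => ?_, ⟨b, hF.1 _ (h _).2⟩, ?_, fun x => ?_⟩
  · simp only [hga, hσF, sum_mul_map_mul fun τ hτ => hagree τ hτ x]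
  · exact fun h0 => hb0 (Subtype.ext_iff.1 h0)
  · rw [hhσ, hσF]

theorem forall_comp_mem_conjSpan_iff [FiniteDimensional k K] [IsAbelianGalois k K]
    (hθ : ∀ σ : K ≃ₐ[k] K, σ ∈ Subgroup.zpowers θ) (hd : 1 ≤ d) (hdV : d < Module.finrank k V)
    (h1 : (1 : K) ∈ V) (hF : IsLeast {E : IntermediateField k K | ∀ x ∈ V, x ∈ E} F)
    {g : K ≃ₗ[k] K} {h : V ≃ₗ[k] V} :
    (∀ f ∈ conjSpan θ V d, g.toLinearMap ∘ₗ f ∘ₗ h.symm.toLinearMap ∈ conjSpan θ V d) ↔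
      ∃ σ, (g, h, σ) ∈ semilinearTriples hF.1 :=
  ⟨exists_mem_semilinearTriples hθ hd hdV h1 hF,
    fun ⟨_, ht⟩ _ hf => comp_mem_conjSpan_of_mem_semilinearTriples ht hf⟩

theorem eq_of_mem_semilinearTriples {g : K ≃ₗ[k] K} {h h' : V ≃ₗ[k] V} {σ τ : F ≃ₐ[k] F}
    (hσ : (g, h, σ) ∈ semilinearTriples hVF) (hτ : (g, h', τ) ∈ semilinearTriples hVF) :
    σ = τ := by
  ext x
  have hg : g 1 ≠ 0 := by simp
  exact mul_right_cancel₀ hg ((hσ.1 x 1).symm.trans (hτ.1 x 1))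

end Semilinear

section Extension

variable {k K : Type*} [Field k] [Field K] [Algebra k K] {V : Submodule k K}
variable {M F : IntermediateField k K}

/-- The multiplier ring `{a | a V ≤ V}`. -/
def multiplierSubalgebra {k A : Type*} [CommSemiring k] [Semiring A] [Algebra k A]
    (V : Submodule k A) : Subalgebra k A where
  carrier := {a | ∀ x ∈ V, a * x ∈ V}
  mul_mem' {a c} ha hc x hx := mul_assoc a c x ▸ ha _ (hc x hx)
  add_mem' {a c} ha hc x hx := add_mul a c x ▸ add_mem (ha x hx) (hc x hx)
  algebraMap_mem' r x hx := Algebra.smul_def r x ▸ V.smul_mem r hx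

theorem mem_iff_forall_mul_mem_of_isGreatest [Algebra.IsAlgebraic k K]
    (hM : IsGreatest {E : IntermediateField k K | ∀ a ∈ E, ∀ x ∈ V, a * x ∈ V} M) {b : K} :
    b ∈ M ↔ ∀ x ∈ V, b * x ∈ V := by
  have hle : subalgebraEquivIntermediateField (multiplierSubalgebra V) ≤ M :=
    hM.2 fun a ha => mem_subalgebraEquivIntermediateField.1 ha
  exact ⟨hM.1 b, fun hb => hle (mem_subalgebraEquivIntermediateField.2 hb)⟩

/-- Multiplication on `V` by the units of a field `M` with `M V ≤ V`. -/
def unitsMulLeft (hMV : ∀ a ∈ M, ∀ x ∈ V, a * x ∈ V) : Mˣ →* (V ≃ₗ[k] V) :=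
  (LinearMap.GeneralLinearGroup.generalLinearEquiv k V).toMonoidHom.comp <| Units.map
    { toFun := fun a : M => (LinearMap.mulLeft k (a : K)).restrict (hMV a a.2)
      map_one' := by ext; simp
      map_mul' := fun a b => LinearMap.ext fun x => Subtype.ext (mul_assoc (a : K) b x) }

theorem coe_unitsMulLeft_apply (hMV : ∀ a ∈ M, ∀ x ∈ V, a * x ∈ V) (a : Mˣ) (x : V) :
    (unitsMulLeft hMV a x : K) = a * x :=
  rfl

/-- The projection `(g, h, σ) ↦ σ` to `Gal(F/k)`; its range is the group `G` of the theorem. -/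
def semilinearTriplesToAlgEquiv (hVF : ∀ x ∈ V, x ∈ F) : semilinearTriples hVF →* (F ≃ₐ[k] F) :=
  ((MonoidHom.snd _ _).comp (MonoidHom.snd _ _)).comp (semilinearTriples hVF).subtype

theorem le_of_forall_mul_mem (h1 : (1 : K) ∈ V) (hVF : ∀ x ∈ V, x ∈ F)
    (hMV : ∀ a ∈ M, ∀ x ∈ V, a * x ∈ V) : M ≤ F :=
  fun a ha => hVF a (mul_one a ▸ hMV a ha 1 h1)

variable (h1 : (1 : K) ∈ V) (hVF : ∀ x ∈ V, x ∈ F)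

/-- An `F`-linear automorphism of `K` and a unit of `M` give a triple with `σ = 1`. -/
def linearProdUnitsToTriples (hMV : ∀ a ∈ M, ∀ x ∈ V, a * x ∈ V) :
    (K ≃ₗ[F] K) × Mˣ →* semilinearTriples hVF where
  toFun p := ⟨(p.1.restrictScalars k, unitsMulLeft hMV p.2, 1), fun x y => p.1.map_smul x y,
    ⟨p.2, le_of_forall_mul_mem h1 hVF hMV (p.2 : M).2⟩, by simp [Subtype.ext_iff], fun _ => rfl⟩
  map_one' := by ext <;> simp
  map_mul' p q := by ext <;> simp [LinearEquiv.mul_apply]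

theorem linearProdUnitsToTriples_injective (hMV : ∀ a ∈ M, ∀ x ∈ V, a * x ∈ V) :
    Function.Injective (linearProdUnitsToTriples h1 hVF hMV) := by
  rintro ⟨g, a⟩ ⟨g', a'⟩ h
  obtain ⟨hg, ha⟩ := Prod.ext_iff.1 (congrArg Subtype.val h)
  have ha1 := congrArg Subtype.val (LinearEquiv.congr_fun (Prod.ext_iff.1 ha).1 ⟨1, h1⟩)
  refine Prod.ext (LinearEquiv.restrictScalars_injective k hg) (Units.ext (Subtype.ext ?_))
  simpa [linearProdUnitsToTriples, coe_unitsMulLeft_apply] using ha1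

theorem range_linearProdUnitsToTriples (hM : ∀ b : K, b ∈ M ↔ ∀ x ∈ V, b * x ∈ V) :
    (linearProdUnitsToTriples h1 hVF fun a ha => (hM a).1 ha).range =
      (semilinearTriplesToAlgEquiv hVF).ker := by
  refine le_antisymm ?_ ?_
  · rintro _ ⟨p, rfl⟩
    rfl
  · rintro ⟨⟨g, h, σ⟩, hg, b, hb, hh⟩ hσ
    obtain rfl : σ = 1 := hσ
    have hbM : (b : K) ∈ M := (hM b).2 fun x hx => hh ⟨x, hx⟩ ▸ (h ⟨x, hx⟩).2
    refine ⟨({ g with map_smul' := hg }, Units.mk0 ⟨b, hbM⟩ ?_), Subtype.ext ?_⟩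
    · exact fun h0 => hb (Subtype.ext (show (b : K) = 0 from Subtype.ext_iff.1 h0))
    · exact Prod.ext rfl (Prod.ext (LinearEquiv.ext fun x => Subtype.ext (hh x).symm) rfl)

/-- The extension of the theorem before passing to matrices, with the triples in place of the
automorphism group of the code and `GL_F(K)` in place of `GL_s(F)`. -/
def semilinearExtension (hM : ∀ b : K, b ∈ M ↔ ∀ x ∈ V, b * x ∈ V) :
    GroupExtension ((K ≃ₗ[F] K) × Mˣ) (semilinearTriples hVF)
      (semilinearTriplesToAlgEquiv hVF).range where
  inl := linearProdUnitsToTriples h1 hVF fun a ha => (hM a).1 ha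
  rightHom := (semilinearTriplesToAlgEquiv hVF).rangeRestrict
  inl_injective := linearProdUnitsToTriples_injective h1 _ _
  range_inl_eq_ker_rightHom := by
    rw [MonoidHom.ker_rangeRestrict]
    exact range_linearProdUnitsToTriples h1 hVF hM
  rightHom_surjective := MonoidHom.rangeRestrict_surjective _

end Extension

section Coordinates

/-- The isomorphism `GL(V) ≃ GL_ι(k)` given by a basis of `V`. -/
noncomputable def autEquivGL {ι k V : Type*} [Fintype ι] [DecidableEq ι] [CommRing k]
    [AddCommGroup V] [Module k V] (b : Module.Basis ι k V) : (V ≃ₗ[k] V) ≃* GL ι k :=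
  (LinearMap.GeneralLinearGroup.generalLinearEquiv k V).symm.trans
    (Units.mapEquiv (LinearMap.toMatrixAlgEquiv b).toMulEquiv)

/-- Replacing the kernel and the middle term of a group extension by isomorphic groups. -/
def groupExtensionCongr {N N' E E' G : Type*} [Group N] [Group N'] [Group E] [Group E'] [Group G]
    (S : GroupExtension N E G) (eN : N' ≃* N) (eE : E ≃* E') : GroupExtension N' E' G where
  inl := eE.toMonoidHom.comp (S.inl.comp eN.toMonoidHom)
  rightHom := S.rightHom.comp eE.symm.toMonoidHom
  inl_injective := eE.injective.comp (S.inl_injective.comp eN.injective)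
  range_inl_eq_ker_rightHom := by
    ext e
    constructor
    · rintro ⟨n, rfl⟩
      simp [MonoidHom.mem_ker]
    · intro he
      obtain ⟨n, hn⟩ : eE.symm e ∈ S.inl.range := S.range_inl_eq_ker_rightHom ▸ he
      exact ⟨eN.symm n, by simp [hn]⟩
  rightHom_surjective := S.rightHom_surjective.comp eE.symm.surjective

variable {k K : Type*} [Field k] [Field K] [Algebra k K] {ℓ m : ℕ}

theorem isGabidulinVector_iff_linearIndependent {v : Fin m → K} :
    IsGabidulinVector k v ↔ LinearIndependent k v := by
  rw [linearIndependent_iff_card_eq_finrank_span, Fintype.card_fin, eq_comm]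
  rfl

/-- The basis of `V_v` formed by the entries of a Gabidulin vector `v`. -/
noncomputable def IsGabidulinVector.basis {v : Fin m → K} (hv : IsGabidulinVector k v) :
    Module.Basis (Fin m) k (entrySpan k v) :=
  Module.Basis.span (isGabidulinVector_iff_linearIndependent.1 hv)

theorem IsGabidulinVector.coe_basis {v : Fin m → K} (hv : IsGabidulinVector k v) (i : Fin m) :
    (hv.basis i : K) = v i :=
  congrArg Subtype.val (Module.Basis.span_apply _ i)

variable (B : Module.Basis (Fin ℓ) k K) (θ : K ≃ₐ[k] K) (d : ℕ) {v : Fin m → K}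

theorem IsGabidulinVector.vectorCode_eq_map (hv : IsGabidulinVector k v) :
    vectorCode v θ d =
      (conjSpan θ (entrySpan k v) d).map (hv.basis.constr K).symm.toLinearMap := by
  rw [vectorCode, conjSpan, Submodule.map_span, Set.image_image]
  congr 1
  ext w
  simp [funext_iff, hv.coe_basis, eq_comm]

theorem IsGabidulinVector.coe_code (hv : IsGabidulinVector k v) :
    (code B v θ d : Set (Matrix (Fin ℓ) (Fin m) k)) =
      LinearMap.toMatrix hv.basis B '' conjSpan θ (entrySpan k v) d := by
  rw [code, liftedCode, hv.vectorCode_eq_map]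
  ext X
  have hX (f : entrySpan k v →ₗ[k] K) :
      epsilon B ((hv.basis.constr K).symm f) = LinearMap.toMatrix hv.basis B f := by
    ext i j
    simp [epsilon, LinearMap.toMatrix_apply]
  simp [hX]

theorem kappa_toMatrix {V : Submodule k K} (b : Module.Basis (Fin m) k V) (g : K ≃ₗ[k] K)
    (h : V ≃ₗ[k] V) (f : V →ₗ[k] K) :
    kappa (autEquivGL B g, autEquivGL b h) (LinearMap.toMatrix b B f) =
      LinearMap.toMatrix b B ((h.arrowCongr g).symm f) := by
  rw [kappa, ← map_inv]
  change LinearMap.toMatrix B B _ * _ * LinearMap.toMatrix b b _ = _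
  rw [← LinearMap.toMatrix_comp, ← LinearMap.toMatrix_comp]
  rfl

theorem mk_mem_codeAut_iff (hv : IsGabidulinVector k v) (g : K ≃ₗ[k] K)
    (h : entrySpan k v ≃ₗ[k] entrySpan k v) :
    (autEquivGL B g, autEquivGL hv.basis h) ∈ codeAut (code B v θ d) ↔
      ∀ f ∈ conjSpan θ (entrySpan k v) d,
        g.toLinearMap ∘ₗ f ∘ₗ h.symm.toLinearMap ∈ conjSpan θ (entrySpan k v) d := by
  have : FiniteDimensional k K := B.finiteDimensional_of_finite
  change kappa _ '' SetLike.coe (code B v θ d) = SetLike.coe (code B v θ d) ↔ _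
  rw [hv.coe_code, Set.image_image]
  simp_rw [kappa_toMatrix]
  rw [← Set.image_image (LinearMap.toMatrix hv.basis B),
    (LinearMap.toMatrix hv.basis B).injective.image_injective.eq_iff,
    LinearEquiv.image_symm_eq_preimage]
  set C := (conjSpan θ (entrySpan k v) d).restrictScalars k
  refine ⟨fun hC f hf => hC.ge hf, fun hC => ?_⟩
  have hCle : C ≤ C.comap (h.arrowCongr g).toLinearMap := hC
  refine congrArg SetLike.coe (Submodule.eq_of_le_of_finrank_eq hCle ?_).symm
  rw [Submodule.comap_equiv_eq_map_symm, LinearEquiv.finrank_map_eq]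

variable {B} {F : IntermediateField k K} {V : Submodule k K} {hVF : ∀ x ∈ V, x ∈ F}
variable {b : Module.Basis (Fin m) k V} {C : Submodule k (Matrix (Fin ℓ) (Fin m) k)}

/-- The pair of matrices of `(g, h)`; `σ` is dropped, as it is determined by `g`. -/
noncomputable def semilinearTriplesToGL (hVF : ∀ x ∈ V, x ∈ F)
    (B : Module.Basis (Fin ℓ) k K) (b : Module.Basis (Fin m) k V) :
    semilinearTriples hVF →* GL (Fin ℓ) k × GL (Fin m) k :=
  ((autEquivGL B).toMonoidHom.prodMap
    ((autEquivGL b).toMonoidHom.comp (MonoidHom.fst _ _))).comp (semilinearTriples hVF).subtype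

theorem semilinearTriplesToGL_injective :
    Function.Injective (semilinearTriplesToGL hVF B b) := by
  rintro ⟨⟨g, h, σ⟩, ht⟩ ⟨⟨g', h', σ'⟩, ht'⟩ heq
  obtain rfl : g = g' := (autEquivGL B).injective (Prod.ext_iff.1 heq).1
  obtain rfl : h = h' := (autEquivGL b).injective (Prod.ext_iff.1 heq).2
  obtain rfl : σ = σ' := eq_of_mem_semilinearTriples ht ht'
  rfl

theorem range_semilinearTriplesToGL
    (hC : ∀ g h, (autEquivGL B g, autEquivGL b h) ∈ codeAut C ↔
      ∃ σ, (g, h, σ) ∈ semilinearTriples hVF) :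
    (semilinearTriplesToGL hVF B b).range = codeAut C := by
  ext p
  obtain ⟨⟨g, h⟩, rfl⟩ := ((autEquivGL B).prodCongr (autEquivGL b)).surjective p
  refine Iff.trans ⟨?_, ?_⟩ (hC g h).symm
  · rintro ⟨⟨⟨g', h', σ⟩, ht⟩, heq⟩
    obtain rfl : g' = g := (autEquivGL B).injective (Prod.ext_iff.1 heq).1
    obtain rfl : h' = h := (autEquivGL b).injective (Prod.ext_iff.1 heq).2
    exact ⟨σ, ht⟩
  · rintro ⟨σ, ht⟩
    exact ⟨⟨_, ht⟩, rfl⟩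

end Coordinates

section Invariants

variable {k K : Type*} [Field k] [Field K] [Algebra k K]

theorem forall_mem_entrySpan_iff_le {m : ℕ} [NeZero m] {v : Fin m → K} (hv1 : v 0 = 1)
    {F E : IntermediateField k K}
    (hF : F.toSubalgebra = Algebra.adjoin k (v '' {i | i ≠ 0})) :
    (∀ x ∈ entrySpan k v, x ∈ E) ↔ F ≤ E := by
  have hspan : (∀ x ∈ entrySpan k v, x ∈ E) ↔ ∀ i, v i ∈ E :=
    (Submodule.span_le (p := E.toSubalgebra.toSubmodule)).trans Set.range_subset_iff
  rw [hspan, ← IntermediateField.toSubalgebra_le_toSubalgebra, hF, Algebra.adjoin_le_iff,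
    Set.image_subset_iff]
  refine ⟨fun h i _ => h i, fun h i => ?_⟩
  by_cases hi : i = 0
  · exact hi ▸ hv1 ▸ one_mem E
  · exact h hi

theorem zpowers_restrictNormal_eq_top [Normal k K] {θ : K ≃ₐ[k] K}
    (hθ : ∀ σ : K ≃ₐ[k] K, σ ∈ Subgroup.zpowers θ) (F : IntermediateField k K) [Normal k F] :
    Subgroup.zpowers (θ.restrictNormal F) = ⊤ := by
  have h : Subgroup.zpowers θ = ⊤ := eq_top_iff.2 fun σ _ => hθ σ
  have hmap := MonoidHom.map_zpowers (AlgEquiv.restrictNormalHom (F := k) (K₁ := K) F) θ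
  rw [h, ← MonoidHom.range_eq_map,
    MonoidHom.range_eq_top.2 (AlgEquiv.restrictNormalHom_surjective K)] at hmap
  exact hmap.symm

end Invariants

end GabidulinLike

theorem mainTheorem1 {k K : Type*} [Field k] [Field K] [Algebra k K] [IsGalois k K]
    {ℓ m : ℕ} [NeZero m]
    (B : Module.Basis (Fin ℓ) k K)
    (θ : K ≃ₐ[k] K) (hθ : ∀ σ : K ≃ₐ[k] K, σ ∈ Subgroup.zpowers θ)
    (v : Fin m → K) (hv : GabidulinLike.IsGabidulinVector k v) (hv1 : v 0 = 1)
    (M : IntermediateField k K)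
    (hM : IsGreatest {E : IntermediateField k K |
      ∀ a ∈ E, ∀ x ∈ GabidulinLike.entrySpan k v, a * x ∈ GabidulinLike.entrySpan k v} M)
    (F : IntermediateField k K)
    (hF : F.toSubalgebra = Algebra.adjoin k (v '' {i | i ≠ 0})) :
    IsLeast {E : IntermediateField k K |
      ∀ x ∈ GabidulinLike.entrySpan k v, x ∈ E} F ∧
    (∃ τ : F ≃ₐ[k] F, (∀ x : F, (τ x : K) = θ (x : K)) ∧
      Subgroup.zpowers τ = ⊤) ∧
    ∃ G : Subgroup (F ≃ₐ[k] F), ∀ d : ℕ, 1 ≤ d → d < m →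
      Nonempty (GroupExtension
        (GL (Fin (Module.finrank F K)) F × Mˣ)
        (GabidulinLike.codeAut (GabidulinLike.code B v θ d)) G) := by
  have : FiniteDimensional k K := B.finiteDimensional_of_finite
  have : IsCyclic (K ≃ₐ[k] K) := ⟨θ, hθ⟩
  have : IsAbelianGalois k K := .of_isCyclic k K
  have hleast : IsLeast {E : IntermediateField k K |
      ∀ x ∈ GabidulinLike.entrySpan k v, x ∈ E} F := by
    simp only [GabidulinLike.forall_mem_entrySpan_iff_le hv1 hF]
    exact isLeast_Ici
  have h1 : (1 : K) ∈ GabidulinLike.entrySpan k v := Submodule.subset_span ⟨0, hv1⟩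
  refine ⟨hleast, ⟨θ.restrictNormal F, θ.restrictNormal_commutes F,
    GabidulinLike.zpowers_restrictNormal_eq_top hθ F⟩,
    (GabidulinLike.semilinearTriplesToAlgEquiv hleast.1).range, fun d hd hdm => ?_⟩
  have hrange := GabidulinLike.range_semilinearTriplesToGL fun g h =>
    (GabidulinLike.mk_mem_codeAut_iff B θ d hv g h).trans
      (GabidulinLike.forall_comp_mem_conjSpan_iff hθ hd (hdm.trans_eq hv.symm) h1 hleast)
  exact ⟨GabidulinLike.groupExtensionCongr
    (GabidulinLike.semilinearExtension h1 hleast.1 fun _ =>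
      GabidulinLike.mem_iff_forall_mul_mem_of_isGreatest hM)
    ((GabidulinLike.autEquivGL (Module.finBasis F K)).symm.prodCongr (.refl _))
    ((MonoidHom.ofInjective GabidulinLike.semilinearTriplesToGL_injective).trans
      (.subgroupCongr hrange))⟩
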